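/- Let $n\ge 1$ and let $\overline{\mathcal Q}_n$ be the set of quasi-Stirling permutations of size $n$, that is, of arrangements $\pi=\pi_1\pi_2\cdots\pi_{2n}$ of the multiset $\{1,1,2,2,\dots,n,n\}$ that avoid the patterns $1212$ and $2121$ (there are no $i<j<k<\ell$ with $\pi_i=\pi_k$, $\pi_j=\pi_\ell$ and $\pi_i\neq\pi_j$). For $\pi\in\overline{\mathcal Q}_n$ let $\operatorname{des}(\pi)$ be the number of $i\in\{1,\dots,2n\}$ with $i=2n$ or $\pi_i>\pi_{i+1}$, let $\operatorname{asc}(\pi)$ be the number of $i\in\{0,\dots,2n-1\}$ with $i=0$ or $\pi_i<\pi_{i+1}$, and let $\operatorname{plat}(\pi)$ be the number of $i\in\{1,\dots,2n-1\}$ with $\pi_i=\pi_{i+1}$. Let $m$ be an index that maximizes $|\{\pi\in\overline{\mathcal Q}_n:\operatorname{des}(\pi)=m\}|$ (equivalently, $|\{\pi\in\overline{\mathcal Q}_n:\operatorname{asc}(\pi)=m\}|$). Then $$\left|m-\frac{3n+1}{4}\right|<1.$$ Similarly, let $m'$ be an index that maximizes $|\{\pi\in\overline{\mathcal Q}_n:\operatorname{plat}(\pi)=m'\}|$.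 Then $$\left|m'-\frac{n+1}{2}\right|<1.$$ -/

import Mathlib

namespace QuasiStirling

/-- The `i`-th entry `π_i` of the word `π = π_1 π_2 … π_r`, for `1 ≤ i ≤ r`
(positions are counted from `1`; the value outside this range is never used). -/
def entry (π : List ℕ) (i : ℕ) : ℕ := π.getD (i - 1) 0

/-- The number of descents: indices `i ∈ {1, …, r}` such that `π_i > π_{i+1}` or `i = r`. -/
def des (π : List ℕ) : ℕ :=
  (Finset.filter (fun i => entry π i > entry π (i + 1) ∨ i = π.length)
    (Finset.Icc 1 π.length)).card

/-- The number of ascents: indices `i ∈ {0, …, r - 1}` such that `π_i < π_{i+1}` or `i = 0`. -/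
def asc (π : List ℕ) : ℕ :=
  (Finset.filter (fun i => entry π i < entry π (i + 1) ∨ i = 0)
    (Finset.range π.length)).card

/-- The number of plateaus: indices `i ∈ {1, …, r - 1}` such that `π_i = π_{i+1}`. -/
def plat (π : List ℕ) : ℕ :=
  (Finset.filter (fun i => entry π i = entry π (i + 1)) (Finset.Ico 1 π.length)).card

/-- The multiset `{1, 1, 2, 2, …, n, n}`. -/
def doubled (n : ℕ) : Multiset ℕ := ∑ k ∈ Finset.Icc 1 n, Multiset.replicate 2 k

/-- Avoidance of the patterns `1212` and `2121`: there is no subsequence (not necessarily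
consecutive) of the form `a b a b` with `a < b` or `b < a`. -/
def Avoids (π : List ℕ) : Prop :=
  ∀ a ∈ π, ∀ b ∈ π, a ≠ b → ¬ List.Sublist [a, b, a, b] π

instance : DecidablePred Avoids := fun π => by
  unfold Avoids
  infer_instance

/-- The set of quasi-Stirling permutations of size `n`: the words whose multiset of entries is
`{1, 1, 2, 2, …, n, n}` and which avoid `1212` and `2121`. -/
def quasiStirling (n : ℕ) : Finset (List ℕ) :=
  Finset.filter Avoids (Multiset.lists (doubled n)).toFinset

theorem mem_quasiStirling {n : ℕ} {π : List ℕ} :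
    π ∈ quasiStirling n ↔ (π : Multiset ℕ) = doubled n ∧ Avoids π := by
  rw [quasiStirling, Finset.mem_filter, Multiset.mem_toFinset, Multiset.mem_lists_iff]
  exact and_congr_left fun _ => eq_comm

/-- The number of quasi-Stirling permutations of size `n` on which the statistic `stat`
takes the value `m`. -/
def count (stat : List ℕ → ℕ) (n m : ℕ) : ℕ :=
  (Finset.filter (fun π => stat π = m) (quasiStirling n)).card

/-- `m` is a most frequent value of the statistic `stat` on the quasi-Stirling permutations
of size `n`. -/
def IsMode (stat : List ℕ → ℕ) (n m : ℕ) : Prop :=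
  ∀ j : ℕ, count stat n j ≤ count stat n m

end QuasiStirling

/-! Give each gap of the word `0 π 0` the weight `x`, `y` or `w` for a descent, ascent or plateau.
The end conventions for `des` and `asc` make the product `x ^ des * y ^ asc * w ^ plat`. Inserting a
new maximal letter into a gap replaces its weight by `x * y`, so a derivation `θ` with `θ x = θ y =
θ w = x * y` performs all such insertions at once.

Avoidance forces a word with maximal letter `N` to be `σ₁ N τ N σ₂` with the letters of `τ` disjoint
from those of `σ₁ σ₂`, and `N τ N` weighs the same as `0 τ 0`. Hence the weighted sums satisfy `u
(n+1) = ∑ C(n,k) u k θ(u (n-k))`. Their exponential generating function solves the Burgers-type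
equation `F' = F * θ F`, which gives `(n+1) u n = θ^n (w^(n+1))`
(`iterate_derivation_of_convolution`, `succ_smul_sum_statistics`).

Descents and ascents: take `θ = X (1+X) d/dX`. As `des + asc + plat = 2n+1`, the result is the
homogenized generating polynomial, and Rolle together with the sign of `f'/f` keeps all its roots in
`[-1,0]`. Substituting `X = t/(1-t)` turns each root `r` into a Bernoulli factor with parameter
`1+r`. The mean, read off from the two top coefficients, is `(3n+1)/4`, and Darroch's theorem
(`abs_mode_sub_mean_lt_one`) puts every mode within distance less than `1` of it.

Plateaus: with `x = y = q` the iterates of `θ` have explicit coefficients, products of two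
binomials, and comparing neighbours locates the maximum. -/

namespace QuasiStirling

/-! ### The equation `F' = F * θ F` and its solution by powers. -/

section Burgers

open PowerSeries

variable {R : Type*} [CommRing R] [Algebra ℝ R]

/-- The coefficientwise extension of a derivation of `R` to power series over `R`. -/
noncomputable def mapDerivation (θ : Derivation ℝ R R) : Derivation ℝ R⟦X⟧ R⟦X⟧ :=
  Derivation.mk'
    { toFun := fun F => PowerSeries.mk fun n => θ (coeff n F)
      map_add' := fun F G => by ext n; simp
      map_smul' := fun r F => by ext n; simp }
    (fun F G => by
      ext n
      simp only [LinearMap.coe_mk, AddHom.coe_mk, coeff_mk, smul_eq_mul, map_add, coeff_mul,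
        map_sum, Derivation.leibniz, Finset.sum_add_distrib]
      congr 1
      rw [← Finset.Nat.sum_antidiagonal_swap]
      rfl)

@[simp]
theorem coeff_mapDerivation (θ : Derivation ℝ R R) (F : R⟦X⟧) (n : ℕ) :
    coeff n (mapDerivation θ F) = θ (coeff n F) := by
  simp [mapDerivation]

theorem derivative_mapDerivation (θ : Derivation ℝ R R) (F : R⟦X⟧) :
    d⁄dX R (mapDerivation θ F) = mapDerivation θ (d⁄dX R F) := by
  ext n
  simp only [coeff_derivative, coeff_mapDerivation, Derivation.leibniz, smul_eq_mul, map_add,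
    Derivation.map_natCast, Derivation.map_one_eq_zero]
  ring

/-- If `F' = F * θ F` then the powers of `F` satisfy `(m + n) (F ^ m)^(n) = m θ^n (F ^ (m + n))`. -/
theorem iterate_derivative_pow_of_burgers (θ : Derivation ℝ R R) (F : R⟦X⟧)
    (hF : d⁄dX R F = F * mapDerivation θ F) (n m : ℕ) (hm : 1 ≤ m) :
    ((m + n : ℕ) : ℝ) • (d⁄dX R)^[n] (F ^ m) = (m : ℝ) • (mapDerivation θ)^[n] (F ^ (m + n)) := by
  induction n generalizing m with
  | zero => simp
  | succ n ih =>
    -- One derivative trades for one `θ` while the exponent rises by one, since `F^(m-1) F' = F^m θ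
    -- F`.
    have h1 : ((m + 1 : ℕ) : ℝ) • d⁄dX R (F ^ m) = (m : ℝ) • mapDerivation θ (F ^ (m + 1)) := by
      rw [Derivation.leibniz_pow, Derivation.leibniz_pow, hF]
      simp only [smul_eq_mul, Nat.add_sub_cancel, ← Nat.cast_smul_eq_nsmul ℝ, smul_smul]
      rw [mul_comm]
      congr 1
      rw [← mul_assoc, ← pow_succ, Nat.sub_add_cancel hm]
    have hcomm : ∀ k (G : R⟦X⟧), (d⁄dX R)^[k] (mapDerivation θ G)
        = mapDerivation θ ((d⁄dX R)^[k] G) := by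
      intro k
      induction k with
      | zero => simp
      | succ k ihk => intro G; rw [Function.iterate_succ_apply, derivative_mapDerivation, ihk,
          Function.iterate_succ_apply]
    have hsmul : ∀ k (r : ℝ) (G : R⟦X⟧), (d⁄dX R)^[k] (r • G) = r • (d⁄dX R)^[k] G := by
      intro k
      induction k with
      | zero => simp
      | succ k ihk =>
        intro r G
        rw [Function.iterate_succ_apply, Function.iterate_succ_apply, ← ihk]
        congr 1
        ext j
        simp [coeff_derivative]
    have h2 := ih (m + 1) (by omega)
    have hne : ((m + 1 : ℕ) : ℝ) ≠ 0 := by positivity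
    apply smul_right_injective _ hne
    simp only
    calc ((m + 1 : ℕ) : ℝ) • ((m + (n + 1) : ℕ) : ℝ) • (d⁄dX R)^[n + 1] (F ^ m)
        = ((m + (n + 1) : ℕ) : ℝ) • (d⁄dX R)^[n] (((m + 1 : ℕ) : ℝ) • d⁄dX R (F ^ m)) := by
          rw [Function.iterate_succ_apply, hsmul, smul_comm]
      _ = (m : ℝ) • mapDerivation θ (((m + 1 + n : ℕ) : ℝ) • (d⁄dX R)^[n] (F ^ (m + 1))) := by
          rw [h1, hsmul, hcomm, Derivation.map_smul, smul_comm, Nat.add_right_comm m 1 n, add_assoc]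
      _ = _ := by
          rw [h2, Derivation.map_smul, smul_comm, Function.iterate_succ_apply']
          rw [Nat.add_right_comm m 1 n, add_assoc]

/-- The solution of the recursion `u (n + 1) = ∑ k, n.choose k * u k * θ (u (n - k))` is
`u n = θ^n (u 0 ^ (n + 1)) / (n + 1)`. -/
theorem iterate_derivation_of_convolution (θ : Derivation ℝ R R) (u : ℕ → R)
    (hu : ∀ n, u (n + 1) = ∑ k ∈ Finset.range (n + 1), n.choose k • (u k * θ (u (n - k))))
    (n : ℕ) : ((n + 1 : ℕ) : ℝ) • u n = θ^[n] (u 0 ^ (n + 1)) := by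
  -- The exponential generating function turns the binomial convolution into a product.
  set F : R⟦X⟧ := PowerSeries.mk fun n => ((n.factorial : ℝ)⁻¹) • u n with hFdef
  have hF : d⁄dX R F = F * mapDerivation θ F := by
    ext n
    rw [coeff_derivative, coeff_mul, Finset.Nat.sum_antidiagonal_eq_sum_range_succ_mk, hFdef]
    simp only [coeff_mk, coeff_mapDerivation, hu, Finset.smul_sum, Finset.sum_mul,
      Derivation.map_smul]
    refine Finset.sum_congr rfl fun k hk => ?_
    have hk' : k ≤ n := by simpa [Nat.lt_succ_iff] using hk
    have h1 : ((n : R) + 1) = algebraMap ℝ R ((n + 1 : ℕ) : ℝ) := by simp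
    rw [h1, mul_comm, ← Algebra.smul_def, ← Nat.cast_smul_eq_nsmul ℝ, smul_smul, smul_smul,
      smul_mul_smul_comm]
    congr 1
    rw [Nat.cast_choose ℝ hk', Nat.factorial_succ]
    push_cast
    have := Nat.factorial_ne_zero n
    have := Nat.factorial_ne_zero k
    have := Nat.factorial_ne_zero (n - k)
    have : ((n : ℝ) + 1) ≠ 0 := by positivity
    field_simp
  -- With `m = 1`, the constant term of the `n`-th derivative of `F` is `u n`.
  have hmain := congrArg constantCoeff (iterate_derivative_pow_of_burgers θ F hF n 1 le_rfl)
  have hθ : ∀ k (G : R⟦X⟧), constantCoeff ((mapDerivation θ)^[k] G) = θ^[k] (constantCoeff G) := by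
    intro k
    induction k with
    | zero => simp
    | succ k ihk =>
      intro G
      rw [Function.iterate_succ_apply, ihk, Function.iterate_succ_apply, ← coeff_zero_eq_constantCoeff_apply,
        coeff_mapDerivation, coeff_zero_eq_constantCoeff_apply]
  have hs : ∀ (r : ℝ) (G : R⟦X⟧), constantCoeff (r • G) = r • constantCoeff G := by
    intro r G
    rw [← coeff_zero_eq_constantCoeff_apply, ← coeff_zero_eq_constantCoeff_apply, LinearMap.map_smul_of_tower]
  have h0 : constantCoeff F = u 0 := by
    rw [← coeff_zero_eq_constantCoeff_apply, hFdef, coeff_mk]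
    simp
  have hn : constantCoeff ((d⁄dX R)^[n] F) = u n := by
    rw [constantCoeff_iterate_derivative, hFdef, coeff_mk]
    have : (n.factorial : ℝ) ≠ 0 := by exact_mod_cast n.factorial_ne_zero
    rw [← map_natCast (algebraMap ℝ R), ← Algebra.smul_def, smul_smul,
      mul_inv_cancel₀ this, one_smul]
  rw [hs, hs, hθ, pow_one, hn, map_pow, h0] at hmain
  simpa [add_comm] using hmain

end Burgers

end QuasiStirling

namespace QuasiStirling

/-! ### Darroch's theorem: mode versus mean of a Poisson binomial distribution. -/

section PoissonBinomial

open Polynomial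

variable {ι : Type*}

/-- The generating polynomial of a sum of independent Bernoulli variables with parameters `p i`. -/
noncomputable def bernoulliPoly (p : ι → ℝ) (s : Finset ι) : ℝ[X] :=
  ∏ i ∈ s, (C (1 - p i) + C (p i) * X)

theorem natDegree_bernoulliPoly_le (p : ι → ℝ) (s : Finset ι) :
    (bernoulliPoly p s).natDegree ≤ s.card := by
  refine (natDegree_prod_le _ _).trans ?_
  rw [Finset.card_eq_sum_ones]
  refine Finset.sum_le_sum fun i _ => ?_
  compute_degree

theorem coeff_zero_bernoulliPoly (p : ι → ℝ) (s : Finset ι) :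
    (bernoulliPoly p s).coeff 0 = ∏ i ∈ s, (1 - p i) := by
  simp [bernoulliPoly, coeff_zero_eq_eval_zero, eval_prod]

variable [DecidableEq ι]

theorem bernoulliPoly_erase (p : ι → ℝ) {s : Finset ι} {i : ι} (hi : i ∈ s) :
    bernoulliPoly p s = (C (1 - p i) + C (p i) * X) * bernoulliPoly p (s.erase i) :=
  (Finset.mul_prod_erase s _ hi).symm

theorem coeff_bernoulliPoly_succ (p : ι → ℝ) {s : Finset ι} {i : ι} (hi : i ∈ s) (k : ℕ) :
    (bernoulliPoly p s).coeff (k + 1) = (1 - p i) * (bernoulliPoly p (s.erase i)).coeff (k + 1)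
      + p i * (bernoulliPoly p (s.erase i)).coeff k := by
  rw [bernoulliPoly_erase p hi, add_mul, coeff_add, coeff_C_mul, mul_assoc, coeff_C_mul,
    coeff_X_mul]

theorem coeff_bernoulliPoly_zero (p : ι → ℝ) {s : Finset ι} {i : ι} (hi : i ∈ s) :
    (bernoulliPoly p s).coeff 0 = (1 - p i) * (bernoulliPoly p (s.erase i)).coeff 0 := by
  rw [bernoulliPoly_erase p hi, add_mul, coeff_add, coeff_C_mul, mul_assoc, coeff_C_mul,
    coeff_X_mul_zero, mul_zero, add_zero]

theorem coeff_bernoulliPoly_card (p : ι → ℝ) (s : Finset ι) :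
    (bernoulliPoly p s).coeff s.card = ∏ i ∈ s, p i := by
  induction s using Finset.induction_on with
  | empty => simp [bernoulliPoly]
  | insert a s ha ih =>
    rw [Finset.card_insert_of_notMem ha, coeff_bernoulliPoly_succ p (Finset.mem_insert_self a s),
      Finset.erase_insert ha, ih, Finset.prod_insert ha, coeff_eq_zero_of_natDegree_lt
      (Nat.lt_succ_of_le (natDegree_bernoulliPoly_le p s)), mul_zero, zero_add]

/-- `k P(S = k) = ∑ i, p i * P(S - S i = k - 1)`. -/
theorem succ_mul_coeff_bernoulliPoly (p : ι → ℝ) (s : Finset ι) (k : ℕ) :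
    ((k : ℝ) + 1) * (bernoulliPoly p s).coeff (k + 1)
      = ∑ i ∈ s, p i * (bernoulliPoly p (s.erase i)).coeff k := by
  have h : derivative (bernoulliPoly p s) = ∑ i ∈ s, C (p i) * bernoulliPoly p (s.erase i) := by
    rw [bernoulliPoly, derivative_prod_finset]
    refine Finset.sum_congr rfl fun i _ => ?_
    rw [mul_comm, bernoulliPoly]
    simp
  have := congrArg (fun f => coeff f k) h
  simp only [coeff_derivative, finsetSum_coeff, coeff_C_mul] at this
  rw [← this, mul_comm]

/-- `(|s| - k) P(S = k) = ∑ i, (1 - p i) * P(S - S i = k)`. -/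
theorem card_sub_mul_coeff_bernoulliPoly (p : ι → ℝ) (s : Finset ι) (k : ℕ) :
    ((s.card : ℝ) - k) * (bernoulliPoly p s).coeff k
      = ∑ i ∈ s, (1 - p i) * (bernoulliPoly p (s.erase i)).coeff k := by
  cases k with
  | zero =>
    rw [Nat.cast_zero, sub_zero, ← nsmul_eq_mul, ← Finset.sum_const]
    exact Finset.sum_congr rfl fun i hi => coeff_bernoulliPoly_zero p hi
  | succ k =>
    have h : (s.card : ℝ) * (bernoulliPoly p s).coeff (k + 1)
        = ∑ i ∈ s, ((1 - p i) * (bernoulliPoly p (s.erase i)).coeff (k + 1)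
          + p i * (bernoulliPoly p (s.erase i)).coeff k) := by
      rw [← nsmul_eq_mul, ← Finset.sum_const]
      exact Finset.sum_congr rfl fun i hi => coeff_bernoulliPoly_succ p hi k
    rw [Finset.sum_add_distrib, ← succ_mul_coeff_bernoulliPoly] at h
    push_cast
    linarith

variable {p : ι → ℝ}

theorem coeff_bernoulliPoly_nonneg {s : Finset ι} (h0 : ∀ i ∈ s, 0 < p i) (h1 : ∀ i ∈ s, p i < 1)
    (k : ℕ) : 0 ≤ (bernoulliPoly p s).coeff k := by
  induction s using Finset.induction_on generalizing k with
  | empty =>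
    simp only [bernoulliPoly, Finset.prod_empty, coeff_one]
    split_ifs <;> norm_num
  | insert a s ha ih =>
    have ih' := ih (fun i hi => h0 i (Finset.mem_insert_of_mem hi))
      (fun i hi => h1 i (Finset.mem_insert_of_mem hi))
    have ha0 := h0 a (Finset.mem_insert_self a s)
    have ha1 := sub_pos.2 (h1 a (Finset.mem_insert_self a s))
    cases k with
    | zero =>
      rw [coeff_bernoulliPoly_zero p (Finset.mem_insert_self a s), Finset.erase_insert ha]
      exact mul_nonneg ha1.le (ih' 0)
    | succ k =>
      rw [coeff_bernoulliPoly_succ p (Finset.mem_insert_self a s), Finset.erase_insert ha]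
      exact add_nonneg (mul_nonneg ha1.le (ih' _)) (mul_nonneg ha0.le (ih' _))

/-- Below the mean, the probabilities of a Poisson binomial distribution increase strictly. -/
theorem coeff_bernoulliPoly_lt_succ {s : Finset ι} (h0 : ∀ i ∈ s, 0 < p i) (h1 : ∀ i ∈ s, p i < 1)
    {k : ℕ} (hk : (k : ℝ) + 1 ≤ ∑ i ∈ s, p i) :
    (bernoulliPoly p s).coeff k < (bernoulliPoly p s).coeff (k + 1) := by
  induction k generalizing s with
  | zero =>
    have hP : 0 < (bernoulliPoly p s).coeff 0 := by
      rw [coeff_zero_bernoulliPoly]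
      exact Finset.prod_pos fun i hi => sub_pos.2 (h1 i hi)
    have hne : s.Nonempty := by
      rw [Finset.nonempty_iff_ne_empty]
      rintro rfl
      simp at hk
      linarith
    have h := succ_mul_coeff_bernoulliPoly p s 0
    have hsum : ∑ i ∈ s, p i * (bernoulliPoly p s).coeff 0
        < ∑ i ∈ s, p i * (bernoulliPoly p (s.erase i)).coeff 0 := by
      refine Finset.sum_lt_sum_of_nonempty hne fun i hi => ?_
      refine mul_lt_mul_of_pos_left ?_ (h0 i hi)
      rw [coeff_bernoulliPoly_zero p hi] at hP ⊢
      have := pos_of_mul_pos_right hP (sub_pos.2 (h1 i hi)).le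
      nlinarith [h0 i hi]
    rw [← Finset.sum_mul] at hsum
    simp only [Nat.cast_zero, zero_add, one_mul] at h hk
    rw [zero_add, h]
    nlinarith
  | succ k ih =>
    have hne : s.Nonempty := by
      rw [Finset.nonempty_iff_ne_empty]
      rintro rfl
      simp at hk
      linarith [Nat.cast_nonneg (α := ℝ) k]
    have h := succ_mul_coeff_bernoulliPoly p s (k + 1)
    -- Erasing `i` lowers the mean by less than `1`, so induction applies to `s.erase i`. The
    -- coefficient for `s` is a convex combination of two neighbouring ones for `s.erase i`, hence
    -- lies strictly below the larger.
    have hsum : ∑ i ∈ s, p i * (bernoulliPoly p s).coeff (k + 1)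
        < ∑ i ∈ s, p i * (bernoulliPoly p (s.erase i)).coeff (k + 1) := by
      refine Finset.sum_lt_sum_of_nonempty hne fun i hi => ?_
      refine mul_lt_mul_of_pos_left ?_ (h0 i hi)
      have hi' : (bernoulliPoly p (s.erase i)).coeff k
          < (bernoulliPoly p (s.erase i)).coeff (k + 1) := by
        refine ih (fun j hj => h0 j (Finset.mem_of_mem_erase hj))
          (fun j hj => h1 j (Finset.mem_of_mem_erase hj)) ?_
        rw [← Finset.add_sum_erase s p hi] at hk
        push_cast at hk
        linarith [h1 i hi]
      rw [coeff_bernoulliPoly_succ p hi]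
      nlinarith [h0 i hi]
    rw [← Finset.sum_mul, ← h] at hsum
    have hP := coeff_bernoulliPoly_nonneg h0 h1 (k + 1)
    have hk0 : (0 : ℝ) < ((k + 1 : ℕ) : ℝ) + 1 := by positivity
    refine lt_of_mul_lt_mul_left ?_ hk0.le
    nlinarith

/-- Above the mean, the probabilities of a Poisson binomial distribution decrease strictly. -/
theorem coeff_bernoulliPoly_succ_lt {s : Finset ι} (h0 : ∀ i ∈ s, 0 < p i) (h1 : ∀ i ∈ s, p i < 1)
    {k : ℕ} (hks : k ≤ s.card) (hk : ∑ i ∈ s, p i ≤ k) :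
    (bernoulliPoly p s).coeff (k + 1) < (bernoulliPoly p s).coeff k := by
  -- Erasing an index keeps `k` and lowers the mean, so the hypothesis on the mean survives.
  induction hn : s.card - k generalizing s with
  | zero =>
    obtain rfl : k = s.card := by omega
    rw [coeff_bernoulliPoly_card, coeff_eq_zero_of_natDegree_lt
      (Nat.lt_succ_of_le (natDegree_bernoulliPoly_le p s))]
    exact Finset.prod_pos h0
  | succ d ih =>
    have hne : s.Nonempty := by
      rw [← Finset.card_pos]
      omega
    have h := card_sub_mul_coeff_bernoulliPoly p s k
    have hsum : ∑ i ∈ s, (1 - p i) * (bernoulliPoly p s).coeff (k + 1)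
        < ∑ i ∈ s, (1 - p i) * (bernoulliPoly p (s.erase i)).coeff k := by
      refine Finset.sum_lt_sum_of_nonempty hne fun i hi => ?_
      refine mul_lt_mul_of_pos_left ?_ (sub_pos.2 (h1 i hi))
      have hc := Finset.card_erase_of_mem hi
      have hi' : (bernoulliPoly p (s.erase i)).coeff (k + 1)
          < (bernoulliPoly p (s.erase i)).coeff k := by
        refine ih (fun j hj => h0 j (Finset.mem_of_mem_erase hj))
          (fun j hj => h1 j (Finset.mem_of_mem_erase hj)) (by omega) ?_ (by omega)
        rw [← Finset.add_sum_erase s p hi] at hk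
        linarith [h0 i hi]
      rw [coeff_bernoulliPoly_succ p hi]
      nlinarith [h1 i hi]
    rw [← Finset.sum_mul, ← h, Finset.sum_sub_distrib, Finset.sum_const, nsmul_one] at hsum
    have hP := coeff_bernoulliPoly_nonneg h0 h1 (k + 1)
    have hk0 : (0 : ℝ) < (s.card : ℝ) - k := by
      rw [sub_pos]
      exact_mod_cast (by omega : k < s.card)
    refine lt_of_mul_lt_mul_left ?_ hk0.le
    nlinarith

/-- A mode of a Poisson binomial distribution differs from the mean by less than `1`. -/
theorem abs_mode_sub_mean_lt_one {s : Finset ι} (h0 : ∀ i ∈ s, 0 ≤ p i) (h1 : ∀ i ∈ s, p i ≤ 1)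
    {m : ℕ} (hm : ∀ k, (bernoulliPoly p s).coeff k ≤ (bernoulliPoly p s).coeff m) :
    |(m : ℝ) - ∑ i ∈ s, p i| < 1 := by
  -- Parameters `1` contribute a shift by `a` and parameters `0` a factor `1`; the strict
  -- inequalities need only the rest.
  set a := (s.filter fun i => p i = 1).card with ha
  set t := s.filter fun i => p i ≠ 1 ∧ p i ≠ 0 with ht
  have hp0 : ∀ i ∈ t, 0 < p i := fun i hi => by
    rw [ht, Finset.mem_filter] at hi
    exact (h0 i hi.1).lt_of_ne hi.2.2.symm
  have hp1 : ∀ i ∈ t, p i < 1 := fun i hi => by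
    rw [ht, Finset.mem_filter] at hi
    exact (h1 i hi.1).lt_of_ne hi.2.1
  have hpoly : bernoulliPoly p s = X ^ a * bernoulliPoly p t := by
    rw [bernoulliPoly, ← Finset.prod_filter_mul_prod_filter_not s fun i => p i = 1]
    congr 1
    · rw [ha, ← Finset.prod_const]
      refine Finset.prod_congr rfl fun i hi => ?_
      rw [(Finset.mem_filter.1 hi).2]
      simp
    · rw [bernoulliPoly, ht, ← Finset.filter_filter]
      refine (Finset.prod_filter_of_ne fun i _ hi => ?_).symm
      rintro h
      exact hi (by simp [h])
  have hsum : ∑ i ∈ s, p i = a + ∑ i ∈ t, p i := by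
    rw [← Finset.sum_filter_add_sum_filter_not s fun i => p i = 1]
    congr 1
    · rw [ha, Finset.card_eq_sum_ones, Nat.cast_sum]
      refine Finset.sum_congr rfl fun i hi => ?_
      rw [(Finset.mem_filter.1 hi).2, Nat.cast_one]
    · rw [ht, ← Finset.filter_filter]
      exact (Finset.sum_filter_of_ne fun i _ hi => hi).symm
  have hpos : 0 < (bernoulliPoly p s).coeff m := by
    refine lt_of_lt_of_le ?_ (hm (t.card + a))
    rw [hpoly, coeff_X_pow_mul, coeff_bernoulliPoly_card]
    exact Finset.prod_pos hp0
  obtain ⟨j, rfl⟩ : ∃ j, m = j + a := by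
    refine ⟨m - a, (Nat.sub_add_cancel ?_).symm⟩
    by_contra hlt
    rw [hpoly, coeff_X_pow_mul', if_neg hlt] at hpos
    exact hpos.false
  have hj : ∀ k, (bernoulliPoly p t).coeff k ≤ (bernoulliPoly p t).coeff j := fun k => by
    simpa [hpoly, coeff_X_pow_mul] using hm (k + a)
  rw [hpoly, coeff_X_pow_mul] at hpos
  rw [hsum, abs_lt]
  push_cast
  constructor
  · by_contra hcon
    exact (coeff_bernoulliPoly_lt_succ hp0 hp1 (k := j) (by linarith)).not_ge (hj (j + 1))
  · by_contra hcon
    have hmean : 0 ≤ ∑ i ∈ t, p i := Finset.sum_nonneg fun i hi => (hp0 i hi).le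
    obtain ⟨k, rfl⟩ : ∃ k, j = k + 1 := by
      refine Nat.exists_eq_succ_of_ne_zero ?_
      rintro rfl
      push_cast at hcon
      linarith
    push_cast at hcon
    have hk : k ≤ t.card := by
      by_contra hlt
      refine hpos.ne' (coeff_eq_zero_of_natDegree_lt ?_)
      exact (natDegree_bernoulliPoly_le p t).trans_lt (by omega)
    exact (coeff_bernoulliPoly_succ_lt hp0 hp1 hk (by linarith)).not_ge (hj k)

end PoissonBinomial

end QuasiStirling

namespace QuasiStirling

/-! ### Quasi-Stirling words and removal of the two copies of a letter. -/

section Words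

theorem sublist_of_cons_sublist_append {c : ℕ} {l A L : List ℕ} (hc : c ∉ A)
    (h : List.Sublist (c :: l) (A ++ L)) : List.Sublist (c :: l) L := by
  induction A with
  | nil => simpa using h
  | cons a A ih =>
    rw [List.mem_cons, not_or] at hc
    rw [List.cons_append] at h
    cases h with
    | cons _ h => exact ih hc.2 h
    | cons_cons _ h => exact absurd rfl hc.1

/-- All occurrences of `c` lie in `M`, so anything between two of them does as well. -/
theorem not_sublist_of_notMem {c d : ℕ} {A M B : List ℕ} (hA : c ∉ A) (hB : c ∉ B) (hM : d ∉ M) :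
    ¬ List.Sublist [c, d, c] (A ++ (M ++ B)) := by
  intro h
  have h1 := List.Sublist.reverse (sublist_of_cons_sublist_append hA h)
  rw [List.reverse_append] at h1
  have h2 := List.Sublist.reverse
    (sublist_of_cons_sublist_append (c := c) (l := [d, c]) (A := B.reverse) (by simpa using hB) (by simpa using h1))
  rw [List.reverse_reverse] at h2
  exact hM (h2.subset (by simp))

theorem avoids_iff {π : List ℕ} :
    Avoids π ↔ ∀ a b, a ≠ b → ¬ List.Sublist [a, b, a, b] π :=
  ⟨fun h a b hab hs => h a (hs.subset (by simp)) b (hs.subset (by simp)) hab hs,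
    fun h a _ b _ hab => h a b hab⟩

theorem Avoids.sublist {π ρ : List ℕ} (h : Avoids π) (hs : List.Sublist ρ π) : Avoids ρ :=
  avoids_iff.2 fun a b hab h' => avoids_iff.1 h a b hab (h'.trans hs)

/-- Inserting `N τ N`, where the letters of `τ` and `N` are new, preserves avoidance. -/
theorem avoids_insert {N : ℕ} {σ₁ τ σ₂ : List ℕ} (h₁ : N ∉ σ₁) (hτ : N ∉ τ) (h₂ : N ∉ σ₂)
    (hd₁ : ∀ b ∈ τ, b ∉ σ₁) (hd₂ : ∀ b ∈ τ, b ∉ σ₂) (hAτ : Avoids τ) (hA : Avoids (σ₁ ++ σ₂)) :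
    Avoids (σ₁ ++ N :: (τ ++ N :: σ₂)) := by
  have key : ∀ c d, c ≠ d → (c ∈ τ ∧ d ∉ τ) ∨ (c = N ∧ d ∉ τ) →
      ¬ List.Sublist [c, d, c] (σ₁ ++ N :: (τ ++ N :: σ₂)) := by
    rintro c d hcd (⟨hc, hd⟩ | ⟨rfl, hd⟩)
    · have hcN : c ≠ N := by rintro rfl; exact hτ hc
      have := not_sublist_of_notMem (c := c) (d := d) (A := σ₁ ++ [N]) (M := τ) (B := N :: σ₂)
        (by simp [hd₁ c hc, hcN]) (by simp [hd₂ c hc, hcN]) hd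
      simpa using this
    · have := not_sublist_of_notMem (c := c) (d := d) (A := σ₁) (M := c :: (τ ++ [c])) (B := σ₂)
        h₁ h₂ (by simp [hd, hcd.symm])
      simpa using this
  rw [avoids_iff]
  intro a b hab hs
  have hs1 : List.Sublist [a, b, a] (σ₁ ++ N :: (τ ++ N :: σ₂)) :=
    List.Sublist.trans (List.sublist_append_left [a, b, a] [b]) hs
  have hs2 : List.Sublist [b, a, b] (σ₁ ++ N :: (τ ++ N :: σ₂)) :=
    List.Sublist.trans (List.sublist_append_right [a] [b, a, b]) hs
  by_cases ha : a ∈ τ <;> by_cases hb : b ∈ τ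
  · have h := hs.filter (fun x => decide (x ∈ τ))
    have e1 : σ₁.filter (fun x => decide (x ∈ τ)) = [] := by
      simpa [List.filter_eq_nil_iff] using fun x hx hxτ => hd₁ x hxτ hx
    have e2 : σ₂.filter (fun x => decide (x ∈ τ)) = [] := by
      simpa [List.filter_eq_nil_iff] using fun x hx hxτ => hd₂ x hxτ hx
    have e3 : τ.filter (fun x => decide (x ∈ τ)) = τ := by simp
    simp only [List.filter_append, List.filter_cons, ha, hb, hτ, e1, e2, e3] at h
    exact avoids_iff.1 hAτ a b hab (by simpa using h)
  · exact key a b hab (Or.inl ⟨ha, hb⟩) hs1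
  · exact key b a hab.symm (Or.inl ⟨hb, ha⟩) hs2
  · by_cases haN : a = N
    · exact key a b hab (Or.inr ⟨haN, hb⟩) hs1
    by_cases hbN : b = N
    · exact key b a hab.symm (Or.inr ⟨hbN, ha⟩) hs2
    have h := hs.filter (fun x => decide (x ∉ τ ∧ x ≠ N))
    have e1 : σ₁.filter (fun x => decide (x ∉ τ ∧ x ≠ N)) = σ₁ := by
      rw [List.filter_eq_self]
      intro x hx
      simp only [decide_eq_true_eq]
      exact ⟨fun hxτ => hd₁ x hxτ hx, fun hxN => h₁ (hxN ▸ hx)⟩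
    have e2 : σ₂.filter (fun x => decide (x ∉ τ ∧ x ≠ N)) = σ₂ := by
      rw [List.filter_eq_self]
      intro x hx
      simp only [decide_eq_true_eq]
      exact ⟨fun hxτ => hd₂ x hxτ hx, fun hxN => h₂ (hxN ▸ hx)⟩
    have e3 : τ.filter (fun x => decide (x ∉ τ ∧ x ≠ N)) = [] := by
      rw [List.filter_eq_nil_iff]
      intro x hx
      simp [hx]
    simp only [List.filter_append, List.filter_cons, e1, e2, e3] at h
    exact avoids_iff.1 hA a b hab (by simpa [ha, hb, haN, hbN] using h)

/-- The words in which each element of `S` occurs exactly twice, and which avoid `1212` and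
`2121`. -/
def words (S : Finset ℕ) : Finset (List ℕ) :=
  Finset.filter Avoids (Multiset.lists (S.val + S.val)).toFinset

theorem mem_words {S : Finset ℕ} {π : List ℕ} :
    π ∈ words S ↔ (∀ a, π.count a = if a ∈ S then 2 else 0) ∧ Avoids π := by
  rw [words, Finset.mem_filter, Multiset.mem_toFinset, Multiset.mem_lists_iff]
  refine and_congr_left fun _ => ?_
  change S.val + S.val = (π : Multiset ℕ) ↔ _
  rw [eq_comm, Multiset.ext]
  refine forall_congr' fun a => ?_
  rw [Multiset.coe_count, Multiset.count_add]
  have h := Multiset.count_eq_of_nodup S.nodup (a := a)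
  simp only [Finset.mem_val] at h
  rw [h]
  split_ifs <;> rfl

theorem mem_of_mem_words {S : Finset ℕ} {π : List ℕ} (h : π ∈ words S) {a : ℕ} :
    a ∈ π ↔ a ∈ S := by
  rw [← List.count_pos_iff, (mem_words.1 h).1]
  split_ifs with hS <;> simp [hS]

theorem words_empty : words ∅ = {[]} := by
  ext π
  rw [Finset.mem_singleton]
  constructor
  · intro h
    rw [List.eq_nil_iff_forall_not_mem]
    intro a ha
    simpa using (mem_of_mem_words h).1 ha
  · rintro rfl
    rw [mem_words, avoids_iff]
    simp

theorem quasiStirling_eq_words (n : ℕ) : quasiStirling n = words (Finset.Icc 1 n) := by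
  have h : doubled n = (Finset.Icc 1 n).val + (Finset.Icc 1 n).val := by
    rw [doubled]
    generalize Finset.Icc 1 n = S
    induction S using Finset.induction_on with
    | empty => simp
    | insert a S ha ih =>
      rw [Finset.sum_insert ha, ih, Finset.insert_val_of_notMem ha, Multiset.replicate_succ,
        Multiset.replicate_one]
      simp only [← Multiset.singleton_add]
      abel
  rw [quasiStirling, words, h]

theorem length_of_mem_words {S : Finset ℕ} {π : List ℕ} (h : π ∈ words S) :
    π.length = 2 * S.card := by
  rw [words, Finset.mem_filter, Multiset.mem_toFinset, Multiset.mem_lists_iff] at h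
  have := congrArg Multiset.card (show S.val + S.val = (π : Multiset ℕ) from h.1)
  simp only [Multiset.card_add, Finset.card_val, Multiset.coe_card] at this
  omega

theorem append_cons_inj {N : ℕ} {A A' B B' : List ℕ} (hA : N ∉ A) (hA' : N ∉ A')
    (h : A ++ N :: B = A' ++ N :: B') : A = A' ∧ B = B' := by
  induction A generalizing A' with
  | nil =>
    cases A' with
    | nil => simpa using h
    | cons a A' => simp at h; simp [h.1] at hA'
  | cons a A ih =>
    cases A' with
    | nil => simp at h; simp [h.1] at hA
    | cons a' A' =>
      simp only [List.cons_append, List.cons.injEq] at h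
      rw [List.mem_cons, not_or] at hA hA'
      obtain ⟨h1, h2⟩ := ih hA.2 hA'.2 h.2
      exact ⟨by rw [h.1, h1], h2⟩

/-- Removing the two copies of a letter `N` from a word decomposes the words on `insert N T`. -/
theorem sum_words_insert {M : Type*} [AddCommMonoid M] {N : ℕ} {T : Finset ℕ} (hN : N ∉ T)
    (f : List ℕ → M) :
    ∑ π ∈ words (insert N T), f π = ∑ K ∈ T.powerset, ∑ τ ∈ words K, ∑ ρ ∈ words (T \ K),
      ∑ p ∈ Finset.range (ρ.length + 1), f (ρ.take p ++ N :: (τ ++ N :: ρ.drop p)) := by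
  have hflat : ∑ K ∈ T.powerset, ∑ τ ∈ words K, ∑ ρ ∈ words (T \ K),
      ∑ p ∈ Finset.range (ρ.length + 1), f (ρ.take p ++ N :: (τ ++ N :: ρ.drop p))
      = ∑ x ∈ T.powerset.sigma fun K => words K ×ˢ
          (words (T \ K)).sigma fun ρ => Finset.range (ρ.length + 1),
        f (x.2.2.1.take x.2.2.2 ++ N :: (x.2.1 ++ N :: x.2.2.1.drop x.2.2.2)) := by
    rw [Finset.sum_sigma]
    refine Finset.sum_congr rfl fun K _ => ?_
    rw [Finset.sum_product]
    refine Finset.sum_congr rfl fun τ _ => ?_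
    rw [Finset.sum_sigma]
  rw [hflat]
  symm
  refine Finset.sum_bij
    (fun x _ => x.2.2.1.take x.2.2.2 ++ N :: (x.2.1 ++ N :: x.2.2.1.drop x.2.2.2)) ?_ ?_ ?_ ?_
  · rintro ⟨K, τ, ρ, p⟩ hx
    simp only [Finset.mem_sigma, Finset.mem_powerset, Finset.mem_product, Finset.mem_range] at hx ⊢
    obtain ⟨hK, hτ, hρ, hp⟩ := hx
    have hsub : ∀ b ∈ τ, b ∉ ρ := fun b hb hb' => by
      rw [mem_of_mem_words hτ] at hb
      rw [mem_of_mem_words hρ] at hb'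
      exact (Finset.mem_sdiff.1 hb').2 hb
    have hNτ : N ∉ τ := fun h => hN (hK ((mem_of_mem_words hτ).1 h))
    have hNρ : N ∉ ρ := fun h => hN (Finset.mem_sdiff.1 ((mem_of_mem_words hρ).1 h)).1
    rw [mem_words]
    constructor
    · intro a
      have h1 := (mem_words.1 hτ).1 a
      have h2 := (mem_words.1 hρ).1 a
      rw [← List.take_append_drop p ρ, List.count_append] at h2
      simp only [List.count_append, List.count_cons, beq_iff_eq]
      by_cases haN : a = N
      · subst haN
        have hK' : a ∉ K := fun h => hN (hK h)
        simp only [hK', hN, Finset.mem_sdiff, if_false, false_and, Finset.mem_insert, true_or,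
          if_true] at h1 h2 ⊢
        omega
      · have haN' : N ≠ a := fun h => haN h.symm
        simp only [haN, haN', Finset.mem_sdiff, if_false, Finset.mem_insert, false_or] at h1 h2 ⊢
        by_cases haK : a ∈ K
        · have := hK haK
          simp only [haK, this, not_true, and_false, if_true, if_false] at h1 h2 ⊢
          omega
        · simp only [haK, not_false_iff, and_true, if_false] at h1 h2 ⊢
          omega
    · exact avoids_insert (fun h => hNρ (List.mem_of_mem_take h)) hNτ
        (fun h => hNρ (List.mem_of_mem_drop h)) (fun b hb h => hsub b hb (List.mem_of_mem_take h))
        (fun b hb h => hsub b hb (List.mem_of_mem_drop h)) (mem_words.1 hτ).2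
        (by rw [List.take_append_drop]; exact (mem_words.1 hρ).2)
  · rintro ⟨K, τ, ρ, p⟩ hx ⟨K', τ', ρ', p'⟩ hx' heq
    simp only [Finset.mem_sigma, Finset.mem_powerset, Finset.mem_product, Finset.mem_range]
      at hx hx' heq
    obtain ⟨hK, hτ, hρ, hp⟩ := hx
    obtain ⟨hK', hτ', hρ', hp'⟩ := hx'
    have hNτ : N ∉ τ := fun h => hN (hK ((mem_of_mem_words hτ).1 h))
    have hNρ : N ∉ ρ := fun h => hN (Finset.mem_sdiff.1 ((mem_of_mem_words hρ).1 h)).1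
    have hNτ' : N ∉ τ' := fun h => hN (hK' ((mem_of_mem_words hτ').1 h))
    have hNρ' : N ∉ ρ' := fun h => hN (Finset.mem_sdiff.1 ((mem_of_mem_words hρ').1 h)).1
    obtain ⟨h1, h2⟩ := append_cons_inj (fun h => hNρ (List.mem_of_mem_take h))
      (fun h => hNρ' (List.mem_of_mem_take h)) heq
    obtain ⟨rfl, h4⟩ := append_cons_inj hNτ hNτ' h2
    obtain rfl : ρ = ρ' := by
      rw [← List.take_append_drop p ρ, h1, h4, List.take_append_drop]
    obtain rfl : p = p' := by
      have := congrArg List.length h1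
      rw [List.length_take, List.length_take] at this
      omega
    obtain rfl : K = K' := by
      ext a
      rw [← mem_of_mem_words hτ, mem_of_mem_words hτ']
    rfl
  · intro π hπ
    obtain ⟨hc, hA⟩ := mem_words.1 hπ
    have hNπ : N ∈ π := (mem_of_mem_words hπ).2 (Finset.mem_insert_self N T)
    obtain ⟨σ₁, π', rfl, hσ₁⟩ := List.eq_append_cons_of_mem hNπ
    have hcN := hc N
    simp only [List.count_append, List.count_cons_self, List.count_eq_zero_of_not_mem hσ₁,
      Finset.mem_insert_self, if_true] at hcN
    have hNπ' : N ∈ π' := by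
      rw [← List.count_pos_iff]
      omega
    obtain ⟨τ, σ₂, rfl, hτ⟩ := List.eq_append_cons_of_mem hNπ'
    simp only [List.count_append, List.count_cons_self, List.count_eq_zero_of_not_mem hτ] at hcN
    have hσ₂ : N ∉ σ₂ := by
      rw [← List.count_eq_zero]
      omega
    -- A letter common to `τ` and `σ₁` would give `b N b N`; one common to `τ` and `σ₂` would give
    -- `N b N b`.
    have hd₁ : ∀ b ∈ τ, b ∉ σ₁ := fun b hb hb' => by
      refine avoids_iff.1 hA b N (by rintro rfl; exact hτ hb) ?_
      exact (List.singleton_sublist.2 hb').append (List.Sublist.cons_cons N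
        ((List.singleton_sublist.2 hb).append (List.Sublist.cons_cons N (List.nil_sublist _))))
    have hd₂ : ∀ b ∈ τ, b ∉ σ₂ := fun b hb hb' => by
      refine avoids_iff.1 hA N b (by rintro rfl; exact hτ hb) ?_
      exact (List.nil_sublist σ₁).append (List.Sublist.cons_cons N
        ((List.singleton_sublist.2 hb).append
          (List.Sublist.cons_cons N (List.singleton_sublist.2 hb'))))
    have hcount : ∀ a, a ≠ N → σ₁.count a + τ.count a + σ₂.count a = if a ∈ T then 2 else 0 := by
      intro a ha
      have h := hc a
      simp only [List.count_append, List.count_cons_of_ne ha.symm, Finset.mem_insert, ha,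
        false_or] at h
      omega
    have hT : ∀ b ∈ τ, b ∈ T := fun b hb => by
      have h := hcount b (by rintro rfl; exact hτ hb)
      have := List.count_pos_iff.2 hb
      by_contra hbT
      rw [if_neg hbT] at h
      omega
    refine ⟨⟨τ.toFinset, τ, σ₁ ++ σ₂, σ₁.length⟩, ?_, ?_⟩
    · simp only [Finset.mem_sigma, Finset.mem_powerset, Finset.mem_product, Finset.mem_range,
        mem_words]
      refine ⟨fun b hb => hT b (List.mem_toFinset.1 hb), ⟨fun a => ?_, ?_⟩, ⟨fun a => ?_, ?_⟩, ?_⟩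
      · simp only [List.mem_toFinset]
        split_ifs with ha
        · have h := hcount a (by rintro rfl; exact hτ ha)
          rwa [List.count_eq_zero_of_not_mem (hd₁ a ha), List.count_eq_zero_of_not_mem (hd₂ a ha),
            if_pos (hT a ha), zero_add, add_zero] at h
        · exact List.count_eq_zero_of_not_mem ha
      · exact hA.sublist ((List.sublist_append_left τ (N :: σ₂)).trans
          ((List.sublist_cons_self _ _).trans (List.sublist_append_right _ _)))
      · simp only [List.count_append, Finset.mem_sdiff, List.mem_toFinset]
        by_cases ha : a ∈ τ
        · simp [ha, List.count_eq_zero_of_not_mem (hd₁ a ha),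
            List.count_eq_zero_of_not_mem (hd₂ a ha)]
        · by_cases haN : a = N
          · subst haN
            simp [List.count_eq_zero_of_not_mem hσ₁, List.count_eq_zero_of_not_mem hσ₂, hN]
          · have h := hcount a haN
            rw [List.count_eq_zero_of_not_mem ha, add_zero] at h
            simpa [ha] using h
      · exact hA.sublist ((List.Sublist.refl σ₁).append (((List.sublist_cons_self N σ₂).trans
          (List.sublist_append_right τ (N :: σ₂))).trans (List.sublist_cons_self _ _)))
      · simp
    · simp
  · intro _ _
    rfl

end Words

/-! ### Weights of words and the recursion for their sums. -/

section Weight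

variable {R : Type*}

/-- The weight of a pair of consecutive letters: `x`, `y` or `w` for a descent, an ascent or a
plateau. -/
def gapWeight (x y w : R) (a b : ℕ) : R := if a < b then y else if b < a then x else w

theorem gapWeight_of_lt (x y w : R) {a b : ℕ} (h : a < b) : gapWeight x y w a b = y := if_pos h

theorem gapWeight_of_gt (x y w : R) {a b : ℕ} (h : b < a) : gapWeight x y w a b = x := by
  rw [gapWeight, if_neg h.not_gt, if_pos h]

theorem gapWeight_self (x y w : R) (a : ℕ) : gapWeight x y w a a = w := by simp [gapWeight]

variable [CommRing R]

/-- The product of the weights of the pairs of consecutive letters of the word `a π z`. -/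
def walkWeight (x y w : R) : ℕ → List ℕ → ℕ → R
  | a, [], z => gapWeight x y w a z
  | a, b :: l, z => gapWeight x y w a b * walkWeight x y w b l z

theorem walkWeight_append_cons (x y w : R) (a b z : ℕ) (l₁ l₂ : List ℕ) :
    walkWeight x y w a (l₁ ++ b :: l₂) z
      = walkWeight x y w a l₁ b * walkWeight x y w b l₂ z := by
  induction l₁ generalizing a with
  | nil => rfl
  | cons c l ih => simp only [List.cons_append, walkWeight, ih, mul_assoc]

/-- Replacing both ends `0` by a maximal letter exchanges the first ascent and the last descent for
a descent and an ascent; for the empty word both sides are a plateau. -/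
theorem walkWeight_max_eq_min (x y w : R) {N : ℕ} {l : List ℕ} (h0 : ∀ b ∈ l, 0 < b)
    (hN : ∀ b ∈ l, b < N) : walkWeight x y w N l N = walkWeight x y w 0 l 0 := by
  cases l with
  | nil => simp [walkWeight, gapWeight_self]
  | cons b l =>
    have key : ∀ b l, (∀ c ∈ b :: l, 0 < c) → (∀ c ∈ b :: l, c < N) →
        x * walkWeight x y w b l N = y * walkWeight x y w b l 0 := by
      intro b l
      induction l generalizing b with
      | nil =>
        intro h0 hN
        rw [walkWeight, walkWeight, gapWeight_of_lt _ _ _ (hN b (by simp)),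
          gapWeight_of_gt _ _ _ (h0 b (by simp)), mul_comm]
      | cons c l ih =>
        intro h0 hN
        have := ih c (fun d hd => h0 d (List.mem_cons_of_mem _ hd))
          (fun d hd => hN d (List.mem_cons_of_mem _ hd))
        rw [walkWeight, walkWeight, mul_left_comm, this, mul_left_comm]
    rw [walkWeight, walkWeight, gapWeight_of_gt _ _ _ (hN b (by simp)),
      gapWeight_of_lt _ _ _ (h0 b (by simp)), key b l h0 hN]

variable [Algebra ℝ R]

/-- If `θ x = θ y = θ w = x * y`, then `θ` of the weight of a word is the sum of the weights of
the words obtained by inserting a new maximal letter. -/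
theorem derivation_walkWeight (θ : Derivation ℝ R R) {x y w : R} (hx : θ x = x * y)
    (hy : θ y = x * y) (hw : θ w = x * y) {N a z : ℕ} {l : List ℕ} (ha : a < N) (hz : z < N)
    (hl : ∀ b ∈ l, b < N) :
    θ (walkWeight x y w a l z) = ∑ p ∈ Finset.range (l.length + 1),
      walkWeight x y w a (l.take p ++ N :: l.drop p) z := by
  have hg : ∀ a b, θ (gapWeight x y w a b) = x * y := fun a b => by
    unfold gapWeight
    split_ifs <;> assumption
  induction l generalizing a with
  | nil => simp [walkWeight, hg, gapWeight_of_lt, gapWeight_of_gt, ha, hz, mul_comm]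
  | cons b l ih =>
    have hb : b < N := hl b (by simp)
    rw [walkWeight, Derivation.leibniz, hg, ih hb fun c hc => hl c (by simp [hc]),
      List.length_cons, Finset.sum_range_succ' _ (l.length + 1), smul_eq_mul, smul_eq_mul,
      Finset.mul_sum]
    congr 1
    rw [List.take_zero, List.drop_zero, List.nil_append, walkWeight, walkWeight,
      gapWeight_of_lt _ _ _ ha, gapWeight_of_gt _ _ _ hb]
    ring

/-- The weighted sum over the quasi-Stirling words on `S`. -/
def wordSum (x y w : R) (S : Finset ℕ) : R := ∑ π ∈ words S, walkWeight x y w 0 π 0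

/-- In `σ₁ N τ N σ₂` the middle weighs as `0 τ 0`, and summing over the position of the block `N τ
N` in `σ₁ σ₂` acts as inserting one maximal letter, that is, as `θ`. -/
theorem wordSum_insert (θ : Derivation ℝ R R) {x y w : R} (hx : θ x = x * y)
    (hy : θ y = x * y) (hw : θ w = x * y) {N : ℕ} {T : Finset ℕ} (hT0 : ∀ b ∈ T, 0 < b)
    (hTN : ∀ b ∈ T, b < N) (hN : 0 < N) :
    wordSum x y w (insert N T) = ∑ K ∈ T.powerset, wordSum x y w K * θ (wordSum x y w (T \ K)) := by
  rw [wordSum, sum_words_insert fun h => (hTN N h).false]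
  refine Finset.sum_congr rfl fun K hK => ?_
  rw [Finset.mem_powerset] at hK
  rw [wordSum, wordSum, map_sum, Finset.sum_mul_sum]
  refine Finset.sum_congr rfl fun τ hτ => Finset.sum_congr rfl fun ρ hρ => ?_
  rw [derivation_walkWeight θ hx hy hw hN hN fun b hb =>
    hTN b (Finset.mem_sdiff.1 ((mem_of_mem_words hρ).1 hb)).1, Finset.mul_sum]
  refine Finset.sum_congr rfl fun p _ => ?_
  rw [walkWeight_append_cons, walkWeight_append_cons, walkWeight_append_cons,
    walkWeight_max_eq_min x y w (fun b hb => hT0 b (hK ((mem_of_mem_words hτ).1 hb)))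
      (fun b hb => hTN b (hK ((mem_of_mem_words hτ).1 hb)))]
  ring

theorem wordSum_eq_convolution (θ : Derivation ℝ R R) {x y w : R} (hx : θ x = x * y)
    (hy : θ y = x * y) (hw : θ w = x * y) {n : ℕ}
    (ih : ∀ k ≤ n, ∀ S : Finset ℕ, (∀ b ∈ S, 0 < b) → S.card = k →
      wordSum x y w S = wordSum x y w (Finset.Icc 1 k))
    {S : Finset ℕ} (h0 : ∀ b ∈ S, 0 < b) (hS : S.card = n + 1) :
    wordSum x y w S = ∑ k ∈ Finset.range (n + 1), n.choose k •
      (wordSum x y w (Finset.Icc 1 k) * θ (wordSum x y w (Finset.Icc 1 (n - k)))) := by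
  have hne : S.Nonempty := by
    rw [← Finset.card_pos]
    omega
  set N := S.max' hne with hNdef
  have hNS : N ∈ S := S.max'_mem hne
  have hc : (S.erase N).card = n := by
    rw [Finset.card_erase_of_mem hNS]
    omega
  rw [← Finset.insert_erase hNS, wordSum_insert θ hx hy hw
    (fun b hb => h0 b (Finset.mem_of_mem_erase hb))
    (fun b hb => (S.le_max' b (Finset.mem_of_mem_erase hb)).lt_of_ne (Finset.ne_of_mem_erase hb))
    (h0 N hNS)]
  have h := Finset.sum_powerset_apply_card (x := S.erase N) fun k =>
    wordSum x y w (Finset.Icc 1 k) * θ (wordSum x y w (Finset.Icc 1 (n - k)))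
  rw [hc] at h
  rw [← h]
  refine Finset.sum_congr rfl fun K hK => ?_
  rw [Finset.mem_powerset] at hK
  have hKc : K.card ≤ n := hc ▸ Finset.card_le_card hK
  have hd : (S.erase N \ K).card = n - K.card := by rw [Finset.card_sdiff_of_subset hK, hc]
  rw [ih K.card hKc K (fun b hb => h0 b (Finset.mem_of_mem_erase (hK hb))) rfl,
    ih (n - K.card) (Nat.sub_le _ _) (S.erase N \ K)
      (fun b hb => h0 b (Finset.mem_of_mem_erase (Finset.mem_sdiff.1 hb).1)) hd]

/-- Both sides obey the same recursion, which sees only cardinalities. -/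
theorem wordSum_eq_of_card (θ : Derivation ℝ R R) {x y w : R} (hx : θ x = x * y)
    (hy : θ y = x * y) (hw : θ w = x * y) (n : ℕ) (S : Finset ℕ) (h0 : ∀ b ∈ S, 0 < b)
    (hS : S.card = n) : wordSum x y w S = wordSum x y w (Finset.Icc 1 n) := by
  induction n using Nat.strong_induction_on generalizing S with
  | _ n ih =>
  cases n with
  | zero =>
    rw [Finset.card_eq_zero] at hS
    rw [hS]
    rfl
  | succ n =>
    have ih' : ∀ k ≤ n, ∀ S : Finset ℕ, (∀ b ∈ S, 0 < b) → S.card = k →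
        wordSum x y w S = wordSum x y w (Finset.Icc 1 k) :=
      fun k hk S => ih k (Nat.lt_succ_of_le hk) S
    rw [wordSum_eq_convolution θ hx hy hw ih' h0 hS, wordSum_eq_convolution θ hx hy hw ih'
      (fun b hb => (Finset.mem_Icc.1 hb).1) (by simp)]

/-- The weighted sum over the quasi-Stirling words of size `n`. -/
theorem succ_smul_wordSum (θ : Derivation ℝ R R) {x y w : R} (hx : θ x = x * y)
    (hy : θ y = x * y) (hw : θ w = x * y) (n : ℕ) :
    ((n + 1 : ℕ) : ℝ) • wordSum x y w (Finset.Icc 1 n) = θ^[n] (w ^ (n + 1)) := by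
  rw [iterate_derivation_of_convolution θ (fun n => wordSum x y w (Finset.Icc 1 n)) fun n =>
    wordSum_eq_convolution θ hx hy hw (fun k _ => wordSum_eq_of_card θ hx hy hw k)
      (fun b hb => (Finset.mem_Icc.1 hb).1) (by simp)]
  simp [wordSum, words_empty, walkWeight, gapWeight_self]

end Weight

/-! ### Recursions for the statistics and their link to the weights. -/

section Statistics

theorem entry_cons_add_two (a : ℕ) (l : List ℕ) (i : ℕ) : entry (a :: l) (i + 2) = entry l (i + 1) := by
  simp [entry]

theorem entry_one (a : ℕ) (l : List ℕ) : entry (a :: l) 1 = a := by simp [entry]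

theorem des_eq_sum (π : List ℕ) : des π = ∑ i ∈ Finset.range π.length,
    if entry π (i + 1) > entry π (i + 2) ∨ i + 1 = π.length then 1 else 0 := by
  rw [des, Finset.card_filter, ← Finset.Ico_succ_right_eq_Icc, Finset.sum_Ico_eq_sum_range]
  refine Finset.sum_congr (by simp) fun i _ => ?_
  rw [add_comm 1 i]

theorem plat_eq_sum (π : List ℕ) : plat π = ∑ i ∈ Finset.range (π.length - 1),
    if entry π (i + 1) = entry π (i + 2) then 1 else 0 := by
  rw [plat, Finset.card_filter, Finset.sum_Ico_eq_sum_range]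
  refine Finset.sum_congr (by simp) fun i _ => ?_
  rw [add_comm 1 i]

theorem des_singleton (a : ℕ) : des [a] = 1 := by
  rw [des_eq_sum, List.length_singleton, Finset.sum_range_one]
  simp

theorem asc_singleton (a : ℕ) : asc [a] = 1 := by
  rw [asc, Finset.card_filter, List.length_singleton, Finset.sum_range_one]
  simp

theorem plat_singleton (a : ℕ) : plat [a] = 0 := by simp [plat]

theorem des_cons_cons (a b : ℕ) (l : List ℕ) :
    des (a :: b :: l) = (if b < a then 1 else 0) + des (b :: l) := by
  rw [des_eq_sum, des_eq_sum, List.length_cons, Finset.sum_range_succ', add_comm]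
  simp [entry_cons_add_two, entry_one]

theorem asc_cons_cons (a b : ℕ) (l : List ℕ) :
    asc (a :: b :: l) = (if a < b then 1 else 0) + asc (b :: l) := by
  rw [asc, asc, Finset.card_filter, Finset.card_filter, List.length_cons, Finset.sum_range_succ',
    List.length_cons, Finset.sum_range_succ', Finset.sum_range_succ' _ l.length]
  simp [entry_cons_add_two, entry_one]
  ring

theorem plat_cons_cons (a b : ℕ) (l : List ℕ) :
    plat (a :: b :: l) = (if a = b then 1 else 0) + plat (b :: l) := by
  rw [plat_eq_sum, plat_eq_sum, List.length_cons, List.length_cons, Nat.add_sub_cancel,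
    Nat.add_sub_cancel, Finset.sum_range_succ', add_comm]
  simp [entry_cons_add_two, entry_one]

theorem walkWeight_eq_statistics {R : Type*} [CommRing R] (x y w : R) {π : List ℕ} (hπ : π ≠ [])
    (h0 : ∀ b ∈ π, 0 < b) :
    walkWeight x y w 0 π 0 = x ^ des π * y ^ asc π * w ^ plat π := by
  induction π with
  | nil => exact absurd rfl hπ
  | cons a l ih =>
    have ha : 0 < a := h0 a (by simp)
    cases l with
    | nil =>
      simp only [walkWeight, gapWeight_of_lt _ _ _ ha, gapWeight_of_gt _ _ _ ha, des_singleton,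
        asc_singleton, plat_singleton]
      ring
    | cons b l =>
      have hb : 0 < b := h0 b (by simp)
      have h := ih (by simp) fun c hc => h0 c (List.mem_cons_of_mem _ hc)
      rw [walkWeight, gapWeight_of_lt _ _ _ hb] at h
      rw [walkWeight, walkWeight, gapWeight_of_lt _ _ _ ha, mul_left_comm, h, des_cons_cons,
        asc_cons_cons, plat_cons_cons, gapWeight]
      rcases lt_trichotomy a b with hab | rfl | hab
      · simp only [hab, hab.not_gt, hab.ne, if_true, if_false]
        ring
      · simp only [lt_irrefl, if_true, if_false]
        ring
      · simp only [hab, hab.not_gt, hab.ne', if_true, if_false]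
        ring

theorem des_add_asc_add_plat {π : List ℕ} (hπ : π ≠ []) :
    des π + asc π + plat π = π.length + 1 := by
  induction π with
  | nil => exact absurd rfl hπ
  | cons a l ih =>
    cases l with
    | nil => simp [des_singleton, asc_singleton, plat_singleton]
    | cons b l =>
      have h := ih (by simp)
      rw [des_cons_cons, asc_cons_cons, plat_cons_cons, List.length_cons]
      split_ifs <;> omega

/-- The joint generating function of descents, ascents and plateaus. -/
theorem succ_smul_sum_statistics {R : Type*} [CommRing R] [Algebra ℝ R] (θ : Derivation ℝ R R)
    {x y w : R} (hx : θ x = x * y) (hy : θ y = x * y) (hw : θ w = x * y) {n : ℕ} (hn : 1 ≤ n) :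
    ((n + 1 : ℕ) : ℝ) • ∑ π ∈ quasiStirling n, x ^ des π * y ^ asc π * w ^ plat π
      = θ^[n] (w ^ (n + 1)) := by
  rw [← succ_smul_wordSum θ hx hy hw, wordSum, quasiStirling_eq_words]
  congr 1
  refine Finset.sum_congr rfl fun π hπ => (walkWeight_eq_statistics x y w ?_ ?_).symm
  · rintro rfl
    have := length_of_mem_words hπ
    simp at this
    omega
  · exact fun b hb => (Finset.mem_Icc.1 ((mem_of_mem_words hπ).1 hb)).1

theorem des_add_asc_add_plat_of_mem {n : ℕ} (hn : 1 ≤ n) {π : List ℕ} (hπ : π ∈ quasiStirling n) :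
    des π + asc π + plat π = 2 * n + 1 := by
  rw [quasiStirling_eq_words] at hπ
  have hl := length_of_mem_words hπ
  rw [Nat.card_Icc, Nat.add_sub_cancel] at hl
  rw [des_add_asc_add_plat, hl]
  rintro rfl
  simp at hl
  omega

end Statistics

end QuasiStirling

namespace QuasiStirling

/-! ### Descents and ascents: real roots and the mean. -/

section RealRooted

open Polynomial

/-- The derivation `X (1 + X) d/dX` of `ℝ[X]`. -/
noncomputable def logisticDerivation : Derivation ℝ ℝ[X] ℝ[X] := (X * (1 + X) : ℝ[X]) • derivative'

theorem logisticDerivation_apply (f : ℝ[X]) :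
    logisticDerivation f = X * (1 + X) * derivative f := rfl

theorem coeff_logisticDerivation (f : ℝ[X]) (m : ℕ) :
    (logisticDerivation f).coeff (m + 1) = (m + 1) * f.coeff (m + 1) + m * f.coeff m := by
  rw [logisticDerivation_apply, mul_assoc, coeff_X_mul, add_mul, one_mul, coeff_add,
    coeff_derivative]
  cases m with
  | zero => simp
  | succ m =>
    rw [coeff_X_mul, coeff_derivative]
    push_cast
    ring

theorem multiset_sum_map_pos {m : Multiset ℝ} (hm : m ≠ 0) {f : ℝ → ℝ} (hf : ∀ a ∈ m, 0 < f a) :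
    0 < (m.map f).sum := by
  induction m using Multiset.induction_on with
  | empty => exact absurd rfl hm
  | cons a m ih =>
    rw [Multiset.map_cons, Multiset.sum_cons]
    have ha := hf a (Multiset.mem_cons_self a m)
    by_cases h : m = 0
    · simpa [h] using ha
    · exact add_pos ha (ih h fun b hb => hf b (Multiset.mem_cons_of_mem hb))

/-- Rolle, counted with multiplicity: at most one root is lost, and so is at least one degree. -/
theorem splits_derivative {f : ℝ[X]} (hf : f.Splits) : (derivative f).Splits := by
  rw [splits_iff_card_roots] at hf ⊢
  have h1 := card_roots_le_derivative f
  have h2 := natDegree_derivative_le f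
  have h3 := card_roots' (derivative f)
  omega

/-- All roots of the polynomial are real and lie in `[-1, 0]`. -/
def RootsInUnit (f : ℝ[X]) : Prop := f.Splits ∧ ∀ r ∈ f.roots, -1 ≤ r ∧ r ≤ 0

theorem RootsInUnit.logisticDerivation {f : ℝ[X]} (hf : RootsInUnit f) (hd : 0 < f.natDegree) :
    RootsInUnit (logisticDerivation f) := by
  obtain ⟨hs, hr⟩ := hf
  have hX : (1 + X : ℝ[X]) = X + C 1 := by rw [add_comm, C_1]
  refine ⟨?_, fun r hrr => ?_⟩
  · rw [logisticDerivation_apply, hX]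
    exact (Splits.X.mul (Splits.X_add_C 1)).mul (splits_derivative hs)
  · have hroot : (QuasiStirling.logisticDerivation f).eval r = 0 := (mem_roots'.1 hrr).2
    rw [logisticDerivation_apply] at hroot
    simp only [eval_mul, eval_X, eval_add, eval_one, mul_eq_zero] at hroot
    rcases hroot with (h | h) | h
    · constructor <;> linarith
    · constructor <;> linarith
    · have hf0 : f ≠ 0 := by
        rintro rfl
        simp at hd
      by_cases hfr : f.eval r = 0
      · exact hr r (mem_roots'.2 ⟨hf0, hfr⟩)
      -- Here `f'/f` is the sum of `1/(r - z)` over the roots `z`; outside `[-1,0]` all terms have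
      -- one sign, so it cannot vanish.
      rw [hs.eval_derivative_eq_eval_mul_sum hfr, mul_eq_zero, or_iff_right hfr] at h
      have hne : f.roots ≠ 0 := hs.roots_ne_zero hd.ne'
      constructor
      · by_contra hlt
        have := multiset_sum_map_pos hne (f := fun z => -(1 / (r - z))) fun z hz => by
          rw [Left.neg_pos_iff, one_div_neg]
          linarith [hr z hz]
        rw [Multiset.sum_map_neg] at this
        linarith
      · by_contra hlt
        have := multiset_sum_map_pos hne (f := fun z => 1 / (r - z)) fun z hz => by
          rw [one_div_pos]
          linarith [hr z hz]
        linarith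

theorem natDegree_logisticDerivation {f : ℝ[X]} (hd : 0 < f.natDegree) :
    (logisticDerivation f).natDegree = f.natDegree + 1 := by
  have hf0 : f ≠ 0 := by
    rintro rfl
    simp at hd
  refine natDegree_eq_of_le_of_coeff_ne_zero ?_ ?_
  · rw [natDegree_le_iff_coeff_eq_zero]
    intro m hm
    obtain ⟨k, rfl⟩ : ∃ k, m = k + 1 := ⟨m - 1, by omega⟩
    rw [coeff_logisticDerivation, coeff_eq_zero_of_natDegree_lt (by omega),
      coeff_eq_zero_of_natDegree_lt (by omega)]
    simp
  · rw [coeff_logisticDerivation, coeff_eq_zero_of_natDegree_lt (by omega), mul_zero, zero_add]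
    exact mul_ne_zero (by positivity) (leadingCoeff_ne_zero.2 hf0)

/-- The iterates of `X (1 + X) d/dX` on `(1 + X) ^ (n + 1)`: degree, roots, and the ratio of the
first two coefficients. -/
theorem iterate_logisticDerivation (n j : ℕ) :
    RootsInUnit (logisticDerivation^[j] ((1 + X) ^ (n + 1))) ∧
    (logisticDerivation^[j] ((1 + X) ^ (n + 1))).natDegree = n + j + 1 ∧
    2 * ((n : ℝ) + j) * (logisticDerivation^[j] ((1 + X) ^ (n + 1))).coeff (n + j)
      = (2 * n * (n + 1) + 2 * j * (n + 1) + j * (j - 1))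
        * (logisticDerivation^[j] ((1 + X) ^ (n + 1))).coeff (n + j + 1) := by
  induction j with
  | zero =>
    have hX : (1 + X : ℝ[X]) = X + C 1 := by rw [add_comm, C_1]
    refine ⟨⟨?_, ?_⟩, ?_, ?_⟩
    · rw [Function.iterate_zero, id, hX]
      exact (Splits.X_add_C 1).pow _
    · intro r hr
      have h := (mem_roots'.1 hr).2
      simp only [Function.iterate_zero, id, IsRoot.def, eval_pow, eval_add, eval_one, eval_X] at h
      have := pow_eq_zero_iff (n.succ_ne_zero) |>.1 h
      constructor <;> linarith
    · rw [Function.iterate_zero, id, hX, natDegree_pow, natDegree_X_add_C, mul_one, add_zero]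
    · rw [Function.iterate_zero, id, coeff_one_add_X_pow, coeff_one_add_X_pow]
      simp
  | succ j ih =>
    obtain ⟨h1, h2, h3⟩ := ih
    rw [Function.iterate_succ_apply']
    set f := logisticDerivation^[j] ((1 + X) ^ (n + 1)) with hf
    have hd : 0 < f.natDegree := by omega
    refine ⟨h1.logisticDerivation hd, by rw [natDegree_logisticDerivation hd, h2, add_assoc n j 1], ?_⟩
    have e1 : n + (j + 1) = (n + j) + 1 := by ring
    rw [e1, coeff_logisticDerivation, coeff_logisticDerivation,
      coeff_eq_zero_of_natDegree_lt (n := n + j + 1 + 1) (by omega)]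
    push_cast
    -- With `B/A` the ratio of the coefficients of degrees `n+j` and `n+j+1`, the quantity `(n+j)
    -- B/A` starts at `n(n+1)` and grows by `n+j+1` at each step; the quadratic in the statement is
    -- twice its value.
    linear_combination ((n : ℝ) + j + 1) * h3

theorem prod_toType_eq (m : Multiset ℝ) (f : ℝ → ℝ) : ∏ i : m, f i = (m.map f).prod := by
  rw [Finset.prod, Multiset.map_univ]

/-- The substitution `X = t / (1 - t)`. -/
theorem sum_X_pow_eq_bernoulliPoly {α : Type*} (s : Finset α) (stat : α → ℕ) {f : ℝ[X]}
    (hf : f.Splits) (hs : ∀ a ∈ s, stat a ≤ f.natDegree)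
    (h : ∑ a ∈ s, (X : ℝ[X]) ^ stat a * (1 + X) ^ (f.natDegree - stat a) = f) :
    ∑ a ∈ s, (X : ℝ[X]) ^ stat a
      = C f.leadingCoeff * bernoulliPoly (fun i : f.roots => 1 + (i : ℝ)) Finset.univ := by
  -- The substitution makes sense at every `t ≠ 1`, which is enough. Each root gives `(1-t)(t/(1-t)
  -- - r) = -r + (1+r) t`.
  refine eq_of_infinite_eval_eq _ _ (Set.Infinite.mono ?_ (Set.infinite_of_finite_compl
    (s := {t : ℝ | t ≠ 1}) ?_))
  · intro t ht
    have ht' : 1 - t ≠ 0 := sub_ne_zero.2 (Ne.symm ht)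
    have h1 : (1 : ℝ) + t / (1 - t) = 1 / (1 - t) := by
      field_simp
      ring
    have h2 := congrArg (fun g => (1 - t) ^ f.natDegree * eval (t / (1 - t)) g) h
    simp only [eval_finsetSum, eval_mul, eval_pow, eval_X, eval_add, eval_one, h1] at h2
    rw [Finset.mul_sum] at h2
    simp only [Set.mem_ofPred_eq, eval_finsetSum, eval_pow, eval_X, eval_mul, eval_C]
    have h3 : ∀ a ∈ s, (1 - t) ^ f.natDegree * ((t / (1 - t)) ^ stat a *
        (1 / (1 - t)) ^ (f.natDegree - stat a)) = t ^ stat a := fun a ha => by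
      obtain ⟨k, hk⟩ := Nat.exists_eq_add_of_le (hs a ha)
      rw [hk, Nat.add_sub_cancel_left, pow_add, div_pow, div_pow, one_pow]
      field_simp
    rw [Finset.sum_congr rfl h3] at h2
    rw [h2, hf.eval_eq_prod_roots, bernoulliPoly, eval_prod, mul_left_comm]
    congr 1
    simp only [eval_add, eval_mul, eval_C, eval_X]
    rw [prod_toType_eq f.roots fun r => 1 - (1 + r) + (1 + r) * t, hf.natDegree_eq_card_roots,
      ← Multiset.prod_replicate, ← Multiset.map_const', ← Multiset.prod_map_mul]
    congr 1
    refine Multiset.map_congr rfl fun r _ => ?_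
    field_simp
    ring
  · have : {t : ℝ | t ≠ 1}ᶜ = {1} := by
      ext t
      simp
    rw [this]
    exact Set.finite_singleton 1

theorem coeff_sum_X_pow_stat (stat : List ℕ → ℕ) (n m : ℕ) :
    (∑ π ∈ quasiStirling n, (X : ℝ[X]) ^ stat π).coeff m = count stat n m := by
  simp [count, finsetSum_coeff, coeff_X_pow, eq_comm]

/-- The common value of the homogenized generating polynomials of descents and of ascents. -/
noncomputable def desPoly (n : ℕ) : ℝ[X] :=
  C (((n + 1 : ℕ) : ℝ)⁻¹) * logisticDerivation^[n] ((1 + X) ^ (n + 1))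

theorem natDegree_desPoly (n : ℕ) : (desPoly n).natDegree = 2 * n + 1 := by
  rw [desPoly, natDegree_C_mul (by positivity), (iterate_logisticDerivation n n).2.1]
  ring

theorem rootsInUnit_desPoly (n : ℕ) : RootsInUnit (desPoly n) := by
  obtain ⟨hs, hr⟩ := (iterate_logisticDerivation n n).1
  refine ⟨hs.C_mul _, ?_⟩
  rwa [desPoly, roots_C_mul _ (by positivity)]

theorem sum_roots_desPoly {n : ℕ} (hn : 1 ≤ n) :
    (desPoly n).roots.sum = -((5 * n + 3) / 4) := by
  have h := (rootsInUnit_desPoly n).1.nextCoeff_eq_neg_sum_roots_mul_leadingCoeff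
  have hd := natDegree_desPoly n
  have hl : (desPoly n).leadingCoeff ≠ 0 := by
    rw [leadingCoeff_ne_zero]
    intro h0
    rw [h0] at hd
    simp at hd
  rw [nextCoeff_of_natDegree_pos (by omega)] at h
  have h3 := (iterate_logisticDerivation n n).2.2
  have h4 : 2 * ((n : ℝ) + n) * (desPoly n).coeff (n + n)
      = (2 * n * (n + 1) + 2 * n * (n + 1) + n * (n - 1)) * (desPoly n).coeff (n + n + 1) := by
    rw [desPoly, coeff_C_mul, coeff_C_mul]
    linear_combination (((n + 1 : ℕ) : ℝ)⁻¹) * h3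
  have e : n + n = 2 * n := by ring
  have hn0 : (n : ℝ) ≠ 0 := by positivity
  rw [leadingCoeff] at h hl
  rw [hd] at h hl
  rw [e] at h4
  rw [Nat.add_sub_cancel] at h
  rw [h] at h4
  apply mul_left_cancel₀ hl
  apply mul_left_cancel₀ hn0
  linear_combination (-1 / 4) * h4

theorem sum_des_homogeneous {n : ℕ} (hn : 1 ≤ n) :
    ∑ π ∈ quasiStirling n, (X : ℝ[X]) ^ des π * (1 + X) ^ (2 * n + 1 - des π) = desPoly n := by
  have h := succ_smul_sum_statistics logisticDerivation (x := (X : ℝ[X])) (y := 1 + X)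
    (w := 1 + X) (by simp [logisticDerivation_apply]) (by simp [logisticDerivation_apply])
    (by simp [logisticDerivation_apply]) hn
  rw [desPoly, ← h, smul_eq_C_mul, ← mul_assoc, ← C_mul, inv_mul_cancel₀ (by positivity), C_1,
    one_mul]
  refine Finset.sum_congr rfl fun π hπ => ?_
  rw [mul_assoc, ← pow_add]
  congr 2
  have := des_add_asc_add_plat_of_mem hn hπ
  omega

/-- Exchanging `x` and `y` leaves `x * y` and `w` unchanged, so the same `θ^n (w^(n+1))` appears. -/
theorem sum_asc_homogeneous {n : ℕ} (hn : 1 ≤ n) :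
    ∑ π ∈ quasiStirling n, (X : ℝ[X]) ^ asc π * (1 + X) ^ (2 * n + 1 - asc π) = desPoly n := by
  have h := succ_smul_sum_statistics logisticDerivation (x := 1 + X) (y := (X : ℝ[X]))
    (w := 1 + X) (by simp [logisticDerivation_apply, mul_comm])
    (by simp [logisticDerivation_apply, mul_comm]) (by simp [logisticDerivation_apply, mul_comm]) hn
  rw [desPoly, ← h, smul_eq_C_mul, ← mul_assoc, ← C_mul, inv_mul_cancel₀ (by positivity), C_1,
    one_mul]
  refine Finset.sum_congr rfl fun π hπ => ?_
  rw [mul_comm ((1 + X) ^ des π), mul_assoc, ← pow_add]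
  congr 2
  have := des_add_asc_add_plat_of_mem hn hπ
  omega

theorem sum_X_pow_des {n : ℕ} (hn : 1 ≤ n) :
    ∑ π ∈ quasiStirling n, (X : ℝ[X]) ^ des π = C (desPoly n).leadingCoeff *
      bernoulliPoly (fun i : (desPoly n).roots => 1 + (i : ℝ)) Finset.univ :=
  sum_X_pow_eq_bernoulliPoly _ _ (rootsInUnit_desPoly n).1
    (fun π hπ => by
      have := des_add_asc_add_plat_of_mem hn hπ
      rw [natDegree_desPoly]
      omega)
    (by rw [natDegree_desPoly, sum_des_homogeneous hn])

theorem sum_X_pow_asc {n : ℕ} (hn : 1 ≤ n) :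
    ∑ π ∈ quasiStirling n, (X : ℝ[X]) ^ asc π = C (desPoly n).leadingCoeff *
      bernoulliPoly (fun i : (desPoly n).roots => 1 + (i : ℝ)) Finset.univ :=
  sum_X_pow_eq_bernoulliPoly _ _ (rootsInUnit_desPoly n).1
    (fun π hπ => by
      have := des_add_asc_add_plat_of_mem hn hπ
      rw [natDegree_desPoly]
      omega)
    (by rw [natDegree_desPoly, sum_asc_homogeneous hn])

theorem count_asc_eq_count_des {n : ℕ} (hn : 1 ≤ n) (m : ℕ) : count asc n m = count des n m := by
  have h := coeff_sum_X_pow_stat asc n m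
  rw [sum_X_pow_asc hn, ← sum_X_pow_des hn, coeff_sum_X_pow_stat] at h
  exact_mod_cast h.symm

theorem isMode_asc_iff {n : ℕ} (hn : 1 ≤ n) (m : ℕ) : IsMode asc n m ↔ IsMode des n m := by
  simp only [IsMode, count_asc_eq_count_des hn]

theorem abs_mode_des_sub_lt_one {n m : ℕ} (hn : 1 ≤ n) (hm : IsMode des n m) :
    |(m : ℝ) - (3 * n + 1) / 4| < 1 := by
  classical
  have hpoly := sum_X_pow_des hn
  obtain ⟨-, hr⟩ := rootsInUnit_desPoly n
  have hsplit := (rootsInUnit_desPoly n).1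
  have hl0 : (desPoly n).leadingCoeff ≠ 0 := by
    rw [leadingCoeff_ne_zero]
    intro h0
    have := natDegree_desPoly n
    rw [h0] at this
    simp at this
  -- At `t = 1` every Bernoulli factor is `1`, so the leading coefficient equals the number of
  -- words.
  have hl : 0 < (desPoly n).leadingCoeff := by
    refine lt_of_le_of_ne ?_ hl0.symm
    have h := congrArg (eval 1) hpoly
    rw [eval_mul, eval_C, bernoulliPoly, eval_prod, Finset.prod_congr rfl (g := fun _ => 1)
      (fun i _ => by simp), Finset.prod_const_one, mul_one] at h
    rw [← h]
    simp [eval_finsetSum]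
  have hmean : ∑ i : (desPoly n).roots, (1 + (i : ℝ)) = (3 * n + 1) / 4 := by
    rw [Finset.sum_add_distrib, Finset.sum_const, Finset.card_univ, Multiset.card_coe, nsmul_one,
      ← hsplit.natDegree_eq_card_roots, natDegree_desPoly]
    have : ∑ i : (desPoly n).roots, (i : ℝ) = (desPoly n).roots.sum := by
      rw [Finset.sum, Multiset.map_univ_coe]
    rw [this, sum_roots_desPoly hn]
    push_cast
    ring
  have hmode := abs_mode_sub_mean_lt_one (p := fun i : (desPoly n).roots => 1 + (i : ℝ))
    (s := Finset.univ) (m := m)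
    (fun i _ => by have := hr i (Multiset.coe_mem); linarith)
    (fun i _ => by have := hr i (Multiset.coe_mem); linarith)
    (fun k => by
      have h1 : (count des n k : ℝ) ≤ count des n m := by exact_mod_cast hm k
      rw [← coeff_sum_X_pow_stat, ← coeff_sum_X_pow_stat, hpoly, coeff_C_mul, coeff_C_mul] at h1
      exact le_of_mul_le_mul_left h1 hl)
  rwa [hmean] at hmode

end RealRooted

/-! ### Plateaus: explicit counts and the location of their maximum. -/

section Plateaus

/-- The coefficients of `θ^(j + 1) (w ^ (b + 1))` when `θ w = θ q = q ^ 2`. -/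
def platCoeff (b j i : ℕ) : ℕ := (j + 1).factorial * ((b + 1).choose (i + 1) * j.choose i)

theorem platCoeff_succ_zero (b j : ℕ) : platCoeff b (j + 1) 0 = (j + 2) * platCoeff b j 0 := by
  simp only [platCoeff, Nat.choose_zero_right, Nat.factorial_succ (j + 1)]
  ring

theorem platCoeff_succ_succ (b j i : ℕ) (hi : i ≤ b) : platCoeff b (j + 1) (i + 1)
    = (b - i) * platCoeff b j i + (i + j + 3) * platCoeff b j (i + 1) := by
  have h1 := Nat.choose_succ_right_eq (b + 1) (i + 1)
  rw [Nat.add_sub_add_right] at h1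
  have h2 : j.choose (i + 1) * (i + 1) + j.choose i * i = j.choose i * j := by
    rw [Nat.choose_succ_right_eq, ← mul_add]
    rcases le_or_gt i j with h | h
    · rw [Nat.sub_add_cancel h]
    · rw [Nat.choose_eq_zero_of_lt h, zero_mul, zero_mul]
  simp only [platCoeff, Nat.factorial_succ (j + 1), Nat.choose_succ_succ' j i]
  zify [hi] at *
  linear_combination (((j + 1).factorial : ℤ) * j.choose i) * h1
    - ((j + 1).factorial : ℤ) * (b + 1).choose (i + 2) * h2

theorem iterate_derivation_pow {R : Type*} [CommRing R] [Algebra ℝ R] (θ : Derivation ℝ R R)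
    {q w : R} (hq : θ q = q * q) (hw : θ w = q * q) (b j : ℕ) :
    θ^[j + 1] (w ^ (b + 1)) = ∑ i ∈ Finset.range (b + 1),
      platCoeff b j i • (w ^ (b - i) * q ^ (i + j + 2)) := by
  induction j with
  | zero =>
    rw [Finset.sum_range_succ', Finset.sum_eq_zero]
    · simp [platCoeff, hw, Derivation.leibniz_pow]
      ring
    · intro i _
      simp [platCoeff]
  | succ j ih =>
    rw [Function.iterate_succ_apply', ih, map_sum]
    have hterm : ∀ i ∈ Finset.range (b + 1),
        θ (platCoeff b j i • (w ^ (b - i) * q ^ (i + j + 2)))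
          = ((b - i) * platCoeff b j i) • (w ^ (b - (i + 1)) * q ^ (i + 1 + (j + 1) + 2))
            + ((i + j + 2) * platCoeff b j i) • (w ^ (b - i) * q ^ (i + (j + 1) + 2)) := by
      intro i _
      rw [map_nsmul, Derivation.leibniz, Derivation.leibniz_pow, Derivation.leibniz_pow, hq, hw]
      simp only [smul_eq_mul, nsmul_eq_mul, Nat.sub_sub]
      rw [show i + j + 2 - 1 = i + j + 1 by omega]
      push_cast
      ring
    -- Differentiating `w` moves index `i` to `i+1`, differentiating `q` keeps it; the move out of
    -- `i = b` has factor `b - b = 0`.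
    rw [Finset.sum_congr rfl hterm, Finset.sum_add_distrib, Finset.sum_range_succ,
      Nat.sub_self, zero_mul, zero_smul, add_zero, Finset.sum_range_succ' _ b,
      Finset.sum_range_succ' _ b, ← add_assoc, ← Finset.sum_add_distrib]
    congr 1
    · refine Finset.sum_congr rfl fun i hi => ?_
      rw [← add_smul, platCoeff_succ_succ b j i (Finset.mem_range.1 hi).le]
      congr 2
      ring
    · rw [platCoeff_succ_zero, zero_add]

open Polynomial in
theorem succ_smul_sum_X_pow_plat (N : ℕ) :
    ((N + 2 : ℕ) : ℝ) • ∑ π ∈ quasiStirling (N + 1), (X : ℝ[X]) ^ plat π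
      = ∑ i ∈ Finset.range (N + 2), platCoeff (N + 1) N i • X ^ (N + 1 - i) := by
  set θ : Derivation ℝ (MvPolynomial (Fin 2) ℝ) (MvPolynomial (Fin 2) ℝ) :=
    MvPolynomial.mkDerivation ℝ fun _ => MvPolynomial.X 0 * MvPolynomial.X 0 with hθ
  have hX : ∀ i, θ (MvPolynomial.X i) = MvPolynomial.X 0 * MvPolynomial.X 0 :=
    MvPolynomial.mkDerivation_X ℝ _
  have h := succ_smul_sum_statistics θ (hX 0) (hX 0) (hX 1) (n := N + 1) (by omega)
  rw [iterate_derivation_pow θ (hX 0) (hX 1)] at h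
  have h' := congrArg (MvPolynomial.aeval ![(1 : ℝ[X]), X]) h
  have e : (N : ℝ) + 1 + 1 = N + 2 := by ring
  simpa [map_sum, e] using h'

theorem succ_mul_count_plat (N i : ℕ) (hi : i ≤ N + 1) :
    (N + 2) * count plat (N + 1) (N + 1 - i) = platCoeff (N + 1) N i := by
  have h := congrArg (fun f => Polynomial.coeff f (N + 1 - i)) (succ_smul_sum_X_pow_plat N)
  simp only [Polynomial.coeff_smul, coeff_sum_X_pow_stat] at h
  simp only [Polynomial.finsetSum_coeff, Polynomial.coeff_smul, Polynomial.coeff_X_pow] at h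
  rw [Finset.sum_eq_single_of_mem i (Finset.mem_range.2 (by omega)) fun k hk hki => by
    rw [if_neg, smul_zero]
    have := Finset.mem_range.1 hk
    omega] at h
  simp only [if_true, nsmul_eq_mul, mul_one, smul_eq_mul] at h
  exact_mod_cast h

theorem count_plat_eq_zero (N m : ℕ) (hm : N + 1 < m) : count plat (N + 1) m = 0 := by
  have h := congrArg (fun f => Polynomial.coeff f m) (succ_smul_sum_X_pow_plat N)
  simp only [Polynomial.coeff_smul, coeff_sum_X_pow_stat] at h
  simp only [Polynomial.finsetSum_coeff, Polynomial.coeff_smul, Polynomial.coeff_X_pow] at h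
  rw [Finset.sum_eq_zero fun k hk => by
    rw [if_neg, smul_zero]
    omega] at h
  rw [smul_eq_mul, mul_eq_zero] at h
  rcases h with h | h
  · exact absurd h (by positivity)
  · exact_mod_cast h

/-- The ratio of consecutive coefficients, cross-multiplied; its comparison with `1` is that of `N -
i` with `i + 1`. -/
theorem platCoeff_ratio (N i : ℕ) (hi : i ≤ N) :
    platCoeff (N + 1) N (i + 1) * ((i + 2) * (i + 1))
      = platCoeff (N + 1) N i * ((N + 1 - i) * (N - i)) := by
  have h1 := Nat.choose_succ_right_eq (N + 2) (i + 1)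
  have h2 := Nat.choose_succ_right_eq N i
  rw [show N + 2 - (i + 1) = N + 1 - i by omega] at h1
  simp only [platCoeff]
  calc _ = (N + 1).factorial * (((N + 2).choose (i + 1 + 1) * (i + 1 + 1))
        * (N.choose (i + 1) * (i + 1))) := by ring
    _ = _ := by
      rw [h1, h2]
      ring

theorem platCoeff_pos (N i : ℕ) (hi : i ≤ N) : 0 < platCoeff (N + 1) N i :=
  Nat.mul_pos (Nat.factorial_pos _)
    (Nat.mul_pos (Nat.choose_pos (by omega)) (Nat.choose_pos hi))

theorem abs_mode_plat_sub_lt_one {n m : ℕ} (hn : 1 ≤ n) (hm : IsMode plat n m) :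
    |(m : ℝ) - (n + 1) / 2| < 1 := by
  obtain ⟨N, rfl⟩ : ∃ N, n = N + 1 := ⟨n - 1, by omega⟩
  have hpos : 0 < count plat (N + 1) m := by
    refine lt_of_lt_of_le ?_ (hm (N + 1))
    have h := succ_mul_count_plat N 0 (by omega)
    have := platCoeff_pos N 0 (by omega)
    rw [← h] at this
    exact Nat.pos_of_mul_pos_left this
  have hmN : m ≤ N + 1 := by
    by_contra hlt
    rw [count_plat_eq_zero N m (by omega)] at hpos
    exact hpos.false
  obtain ⟨i, hi, rfl⟩ : ∃ i ≤ N + 1, m = N + 1 - i := ⟨N + 1 - m, by omega, by omega⟩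
  have hmax : ∀ k ≤ N + 1, platCoeff (N + 1) N k ≤ platCoeff (N + 1) N i := fun k hk => by
    rw [← succ_mul_count_plat N k hk, ← succ_mul_count_plat N i hi]
    exact Nat.mul_le_mul_left _ (hm _)
  -- The index `i = N + 1` means no plateau at all, where the count is `0`.
  have hiN : i ≤ N := by
    by_contra hlt
    have h := succ_mul_count_plat N i hi
    rw [platCoeff, Nat.choose_eq_zero_of_lt (by omega : N < i), mul_zero, mul_zero] at h
    exact (Nat.mul_pos (Nat.succ_pos (N + 1)) hpos).ne' h
  have hlow : N ≤ 2 * i + 1 := by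
    have h := platCoeff_ratio N i hiN
    have h1 := hmax (i + 1) (by omega)
    by_contra hlt
    have h2 : (i + 2) * (i + 1) < (N + 1 - i) * (N - i) :=
      Nat.mul_lt_mul_of_lt_of_le (by omega) (by omega) (by omega)
    have h3 := Nat.mul_le_mul_right ((i + 2) * (i + 1)) h1
    rw [h] at h3
    exact (Nat.le_of_mul_le_mul_left h3 (platCoeff_pos N i hiN)).not_gt h2
  have hup : 2 * i ≤ N + 1 := by
    cases i with
    | zero => omega
    | succ k =>
      have h := platCoeff_ratio N k (by omega)
      have h1 := hmax k (by omega)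
      by_contra hlt
      have h2 : (N + 1 - k) * (N - k) < (k + 2) * (k + 1) :=
        Nat.mul_lt_mul_of_lt_of_le (by omega) (by omega) (by omega)
      have h3 := Nat.mul_le_mul_right ((N + 1 - k) * (N - k)) h1
      rw [← h] at h3
      exact (Nat.le_of_mul_le_mul_left h3 (platCoeff_pos N (k + 1) hiN)).not_gt h2
  -- The deviation is `N/2 - i`, which `hlow` and `hup` bound by `1/2` in absolute value.
  rw [Nat.cast_sub hi, abs_lt]
  have h1 : (N : ℝ) ≤ 2 * i + 1 := by exact_mod_cast hlow
  have h2 : (2 : ℝ) * i ≤ N + 1 := by exact_mod_cast hup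
  push_cast
  constructor <;> linarith

end Plateaus

end QuasiStirling

theorem mainTheorem10 (n : ℕ) (hn : 1 ≤ n) :
    (∀ m : ℕ, QuasiStirling.IsMode QuasiStirling.des n m ↔
      QuasiStirling.IsMode QuasiStirling.asc n m) ∧
    (∀ m : ℕ, QuasiStirling.IsMode QuasiStirling.des n m →
      |(m : ℝ) - (3 * (n : ℝ) + 1) / 4| < 1) ∧
    (∀ m : ℕ, QuasiStirling.IsMode QuasiStirling.asc n m →
      |(m : ℝ) - (3 * (n : ℝ) + 1) / 4| < 1) ∧
    (∀ m' : ℕ, QuasiStirling.IsMode QuasiStirling.plat n m' →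
      |(m' : ℝ) - ((n : ℝ) + 1) / 2| < 1) :=
  ⟨fun m => (QuasiStirling.isMode_asc_iff hn m).symm,
    fun _ hm => QuasiStirling.abs_mode_des_sub_lt_one hn hm,
    fun m hm => QuasiStirling.abs_mode_des_sub_lt_one hn ((QuasiStirling.isMode_asc_iff hn m).1 hm),
    fun _ hm => QuasiStirling.abs_mode_plat_sub_lt_one hn hm⟩
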